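/- **Systems and invariant covers.** A system $\Sigma=(X,U,F)$ consists of nonempty sets $X,U$ and a set-valued map $F:X\times U\rightrightarrows X$ with nonempty values. Let $Q\subseteq X$ be nonempty. An invariant cover $(\mathcal A,G)$ of $\Sigma$ and $Q$ is a finite set $\mathcal A$ of subsets of $Q$ whose union is $Q$, together with a map $G:\mathcal A\to U$ such that $F(A,G(A)):=\bigcup_{x\in A}F(x,G(A))\subseteq Q$ for all $A\in\mathcal A$. Its data rate is $R(\mathcal A,G):=\log_2\#\mathcal A$. **Entropy.** Let $\tau\ge 1$ be an integer and $\mathcal S\subseteq\mathcal A^{\{0,\dots,\tau-1\}}$. For $\alpha\in\mathcal S$ and $0\le t<\tau-1$ let $P(\alpha|_{[0;t]})$ be the set of all $\hat\alpha(t+1)$ with $\hat\alpha\in\mathcal S$ and $\hat\alpha(s)=\alpha(s)$ for all $0\le s\le t$; for $t=\tau-1$ put $P(\alpha|_{[0;\tau-1]}):=\{\hat\alpha(0)\mid\hat\alpha\in\mathcal S\}$. The set $\mathcal S$ is $(\tau,Q)$-spanning if $\{\hat\alpha(0)\mid\hat\alpha\in\mathcal S\}$ covers $Q$ and $F(\alpha(t),G(\alpha(t)))\subseteq\bigcup_{A'\in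 P(\alpha|_{[0;t]})}A'$ for all $\alpha\in\mathcal S$ and $0\le t<\tau-1$. Put $N(\mathcal S):=\max_{\alpha\in\mathcal S}\prod_{t=0}^{\tau-1}\#P(\alpha|_{[0;t]})$, let $r_{\rm inv}(\tau,Q)$ be the minimum of $N(\mathcal S)$ over all $(\tau,Q)$-spanning $\mathcal S$, and let $h(\mathcal A,G):=\lim_{\tau\to\infty}\frac1\tau\log_2 r_{\rm inv}(\tau,Q)$ (the limit exists). The invariance feedback entropy is $h_{\rm inv}:=\inf_{(\mathcal A,G)}h(\mathcal A,G)$ over all invariant covers of $\Sigma$ and $Q$, with $\inf\emptyset=\infty$. **Corollary.** Let $n\ge 1$, $A\in\mathbb R^{n\times n}$, $B\in\mathbb R^{n\times m}$, let $W\subseteq Q\subseteq\mathbb R^n$ be nonempty with $W$ Lebesgue measurable and $Q$ compact, let $\emptyset\ne U\subseteq\mathbb R^m$, and consider the system $\Sigma=(\mathbb R^n,U,F)$ with $F(x,u)=Ax+Bu+W$. With $\mu$ the Lebesgue measure, let $$a:=|\det A|\cdot\frac{\mu(Q)}{\left(\mu(Q)^{1/n}-\mu(W)^{1/n}\right)^n}\in[0,\infty],$$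 with $0\cdot\infty=0$, $c/0=\infty$ for $c>0$, $\log_2 0=-\infty$, and, in the degenerate case $\mu(Q)=0$, $0/0=0$. Suppose that $a<\infty$ and that $(\mathcal C,H)$ is an invariant cover of $\Sigma$ and $Q$ with $R(\mathcal C,H)=\log_2\lceil a\rceil$. Then $h_{\rm inv}$ is finite and $$R(\mathcal C,H)\le h_{\rm inv}+\log_2\left(1+2^{-h_{\rm inv}}\right),\qquad R(\mathcal C,H)\le h_{\rm inv}+1.$$ -/

import Mathlib

open Set Filter Topology MeasureTheory
open scoped ENNReal

noncomputable section

namespace InvFeedback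

/-- A system `(X, U, F)`: nonempty state and input alphabets and a strict set-valued
transition function `F : X × U ⇉ X`. -/
structure ControlSystem (X U : Type*) where
  F : X → U → Set X
  strict : ∀ x u, (F x u).Nonempty
  nonempty_state : Nonempty X
  nonempty_input : Nonempty U

/-- An invariant cover `(𝒜, G)` of a system and a set `Q`: a finite set `𝒜` of subsets of `Q`
whose union contains `Q`, and a map `G : 𝒜 → U` with `F(C, G(C)) ⊆ Q` for all `C ∈ 𝒜`. -/
structure InvariantCover {X U : Type*} (sys : ControlSystem X U) (Q : Set X) where
  elems : Set (Set X)
  finite : elems.Finite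
  subset : ∀ C ∈ elems, C ⊆ Q
  covers : Q ⊆ ⋃₀ elems
  G : elems → U
  invariant : ∀ C : elems, (⋃ x ∈ (C : Set X), sys.F x (G C)) ⊆ Q

/-- The first elements `{α(0) | α ∈ S}` of the sequences in `S`. -/
def initialElems {ι : Type*} {τ : ℕ} (S : Set (Fin τ → ι)) : Set ι :=
  {A | ∃ β ∈ S, ∃ h : 0 < τ, β ⟨0, h⟩ = A}

/-- The set `P(α|_{[0;t]})`: for `t < τ - 1` it consists of the elements that extend
`α(0) ⋯ α(t)` within `S`; for `t = τ - 1` it is by convention the set of first elements. -/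
def P {ι : Type*} {τ : ℕ} (S : Set (Fin τ → ι)) (α : Fin τ → ι) (t : Fin τ) : Set ι :=
  if h : (t : ℕ) + 1 < τ then
    {A | ∃ β ∈ S, (∀ s ≤ t, β s = α s) ∧ β ⟨(t : ℕ) + 1, h⟩ = A}
  else initialElems S

/-- The expansion number `N(S) = max_{α ∈ S} ∏_{t=0}^{τ-1} #P(α|_{[0;t]})`. -/
def expansionNumber {ι : Type*} {τ : ℕ} (S : Set (Fin τ → ι)) : ℕ :=
  sSup ((fun α : Fin τ → ι => ∏ t : Fin τ, (P S α t).ncard) '' S)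

namespace InvariantCover

variable {X U : Type*} {sys : ControlSystem X U} {Q : Set X}

/-- `S` is `(τ, Q)`-spanning in the invariant cover. -/
def IsSpanning (C : InvariantCover sys Q) {τ : ℕ} (S : Set (Fin τ → C.elems)) : Prop :=
  (Q ⊆ ⋃ A ∈ initialElems S, (A : Set X)) ∧
  ∀ α ∈ S, ∀ t : Fin τ, (t : ℕ) + 1 < τ →
    (⋃ x ∈ (α t : Set X), sys.F x (C.G (α t))) ⊆ ⋃ A ∈ P S α t, (A : Set X)

/-- `r_inv(τ, Q)`: the smallest expansion number of a `(τ, Q)`-spanning set. -/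
def rInv (C : InvariantCover sys Q) (τ : ℕ) : ℕ :=
  sInf {N | ∃ S : Set (Fin τ → C.elems), C.IsSpanning S ∧ N = expansionNumber S}

/-- The entropy `h(𝒜, G) = lim_{τ → ∞} (1/τ) log₂ r_inv(τ, Q)` of an invariant cover. -/
def entropy (C : InvariantCover sys Q) : ℝ :=
  limUnder atTop (fun τ : ℕ => Real.logb 2 (C.rInv τ) / τ)

/-- The data rate `R(𝒜, G) = log₂ #𝒜` of an invariant cover (as static coder-controller). -/
def dataRate (C : InvariantCover sys Q) : ℝ :=
  Real.logb 2 C.elems.ncard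

end InvariantCover

/-- The invariance feedback entropy: the infimum of the entropies of all invariant covers,
`∞` if there are none. -/
def invEntropy {X U : Type*} (sys : ControlSystem X U) (Q : Set X) : EReal :=
  ⨅ C : InvariantCover sys Q, (C.entropy : EReal)

/-- The system with states `ℝⁿ`, inputs `U ⊆ ℝᵐ` and `F(x, u) = A x + B u + W`. -/
def linearSystem {n m : ℕ} (A : Matrix (Fin n) (Fin n) ℝ) (B : Matrix (Fin n) (Fin m) ℝ)
    (W : Set (Fin n → ℝ)) (hW : W.Nonempty) (U : Set (Fin m → ℝ)) (hU : U.Nonempty) :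
    ControlSystem (Fin n → ℝ) U where
  F x u := (fun w => A.mulVec x + B.mulVec (u : Fin m → ℝ) + w) '' W
  strict _ _ := hW.image _
  nonempty_state := inferInstance
  nonempty_input := hU.to_subtype

/-- `|det A| μ(Q) / (μ(Q)^{1/n} - μ(W)^{1/n})^n` in `[0, ∞]`, with `0 · ∞ = 0`.
In the undefined case `0 / 0`, that is `μ(Q) = 0`, the value is `0`. -/
def lossConstant {n : ℕ} (A : Matrix (Fin n) (Fin n) ℝ) (W Q : Set (Fin n → ℝ)) : ℝ≥0∞ :=
  ENNReal.ofReal |A.det| *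
    (volume Q / (volume Q ^ (1 / (n : ℝ)) - volume W ^ (1 / (n : ℝ))) ^ n)

/-- The binary logarithm `[0, ∞] → [-∞, ∞]`, with `log₂ 0 = -∞` and `log₂ ∞ = ∞`. -/
def log2 (x : ℝ≥0∞) : EReal :=
  ENNReal.log x / ((Real.log 2 : ℝ) : EReal)

/-! The limit defining the entropy of an invariant cover exists, by subadditivity. -/

/-- Elements at position `t` of sequences in `S` that agree with `α` before `t`. -/
def D {ι : Type*} {τ : ℕ} (S : Set (Fin τ → ι)) (α : Fin τ → ι) (t : Fin τ) : Set ι :=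
  {A | ∃ β ∈ S, (∀ s < t, β s = α s) ∧ β t = A}

lemma P_eq_D {ι : Type*} {k : ℕ} (S : Set (Fin (k + 1) → ι)) (α : Fin (k + 1) → ι)
    (t : Fin (k + 1)) : P S α t = D S α (finRotate (k + 1) t) := by
  unfold P
  split_ifs with h
  · have ht : finRotate (k + 1) t = ⟨(t : ℕ) + 1, h⟩ := by
      exact finRotate_of_lt (k := (t : ℕ)) (by omega)
    rw [ht]
    ext A
    simp only [D, mem_ofPred_eq]
    constructor
    · rintro ⟨β, hβ, h1, h2⟩
      exact ⟨β, hβ, fun s hs => h1 s (by rw [Fin.lt_def] at hs; rw [Fin.le_def]; simp at hs; omega), h2⟩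
    · rintro ⟨β, hβ, h1, h2⟩
      exact ⟨β, hβ, fun s hs => h1 s (by rw [Fin.le_def] at hs; rw [Fin.lt_def]; simp; omega), h2⟩
  · have ht : t = Fin.last k := by
      apply Fin.ext; simp; omega
    rw [ht, finRotate_last]
    ext A
    simp [D, initialElems]

lemma prod_P_eq_prod_D {ι : Type*} {τ : ℕ} (S : Set (Fin τ → ι)) (α : Fin τ → ι) :
    ∏ t, (P S α t).ncard = ∏ t, (D S α t).ncard := by
  cases τ with
  | zero => simp
  | succ k =>
    simp_rw [P_eq_D]
    exact Equiv.prod_comp (finRotate (k + 1)) (fun t => (D S α t).ncard)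

/-- All concatenations of a sequence in `S₁` with a sequence in `S₂`. -/
def concat {ι : Type*} {a b : ℕ} (S₁ : Set (Fin a → ι)) (S₂ : Set (Fin b → ι)) :
    Set (Fin (a + b) → ι) :=
  {α | ∃ α₁ ∈ S₁, ∃ α₂ ∈ S₂, α = Fin.append α₁ α₂}

lemma D_concat_left {ι : Type*} {a b : ℕ} (S₁ : Set (Fin a → ι)) (S₂ : Set (Fin b → ι))
    (hS₂ : S₂.Nonempty) (α₁ : Fin a → ι) (α₂ : Fin b → ι) (t : Fin a) :
    D (concat S₁ S₂) (Fin.append α₁ α₂) (Fin.castAdd b t) = D S₁ α₁ t := by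
  ext A
  simp only [D, mem_ofPred_eq]
  constructor
  · rintro ⟨β, ⟨β₁, h₁, β₂, h₂, rfl⟩, h, hA⟩
    refine ⟨β₁, h₁, fun s hs => ?_, by simpa using hA⟩
    simpa using h (Fin.castAdd b s) hs
  · rintro ⟨β₁, h₁, h, hA⟩
    obtain ⟨β₂, h₂⟩ := hS₂
    refine ⟨_, ⟨β₁, h₁, β₂, h₂, rfl⟩, fun s => ?_, by simpa using hA⟩
    refine Fin.addCases (fun s hs => ?_) (fun s hs => ?_) s
    · simpa using h s hs
    · exfalso
      have := Fin.lt_def.1 hs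
      simp only [Fin.val_natAdd, Fin.val_castAdd] at this
      omega

lemma D_concat_right {ι : Type*} {a b : ℕ} (S₁ : Set (Fin a → ι)) (S₂ : Set (Fin b → ι))
    (α₁ : Fin a → ι) (h₁ : α₁ ∈ S₁) (α₂ : Fin b → ι) (t : Fin b) :
    D (concat S₁ S₂) (Fin.append α₁ α₂) (Fin.natAdd a t) = D S₂ α₂ t := by
  ext A
  simp only [D, mem_ofPred_eq]
  constructor
  · rintro ⟨β, ⟨β₁, h₁, β₂, h₂, rfl⟩, h, hA⟩
    refine ⟨β₂, h₂, fun s hs => ?_, by simpa using hA⟩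
    simpa using h (Fin.natAdd a s)
      (Fin.lt_def.2 (Nat.add_lt_add_left (Fin.lt_def.1 hs) a))
  · rintro ⟨β₂, h₂, h, hA⟩
    refine ⟨_, ⟨α₁, h₁, β₂, h₂, rfl⟩, fun s => ?_, by simpa using hA⟩
    refine Fin.addCases (fun s hs => ?_) (fun s hs => ?_) s
    · simp
    · simpa using h s (Fin.lt_def.2 (Nat.lt_of_add_lt_add_left (Fin.lt_def.1 hs)))

lemma le_expansionNumber {ι : Type*} [Finite ι] {τ : ℕ} {S : Set (Fin τ → ι)} {α : Fin τ → ι}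
    (hα : α ∈ S) : ∏ t, (D S α t).ncard ≤ expansionNumber S := by
  rw [← prod_P_eq_prod_D]
  exact le_csSup (S.toFinite.image _).bddAbove (mem_image_of_mem _ hα)

lemma expansionNumber_concat_le {ι : Type*} [Finite ι] {a b : ℕ} (S₁ : Set (Fin a → ι))
    (S₂ : Set (Fin b → ι)) :
    expansionNumber (concat S₁ S₂) ≤ expansionNumber S₁ * expansionNumber S₂ := by
  rcases (concat S₁ S₂).eq_empty_or_nonempty with h | h
  · simp [expansionNumber, h]
  · refine csSup_le (h.image _) ?_
    rintro _ ⟨_, ⟨α₁, h₁, α₂, h₂, rfl⟩, rfl⟩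
    simp only [prod_P_eq_prod_D]
    rw [Fin.prod_univ_add]
    simp only [D_concat_left S₁ S₂ ⟨α₂, h₂⟩, D_concat_right S₁ S₂ α₁ h₁]
    exact Nat.mul_le_mul (le_expansionNumber h₁) (le_expansionNumber h₂)

lemma one_le_expansionNumber {ι : Type*} [Finite ι] {τ : ℕ} {S : Set (Fin τ → ι)}
    (hS : S.Nonempty) : 1 ≤ expansionNumber S := by
  obtain ⟨α, hα⟩ := hS
  refine le_trans ?_ (le_expansionNumber hα)
  refine Nat.succ_le_of_lt (Finset.prod_pos (R := ℕ) fun t _ => ?_)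
  exact Nat.pos_of_ne_zero (ncard_ne_zero_of_mem (a := α t) ⟨α, hα, fun _ _ => rfl, rfl⟩)

lemma initialElems_eq_D {ι : Type*} {τ : ℕ} (S : Set (Fin τ → ι)) (α : Fin τ → ι) (h : 0 < τ) :
    initialElems S = D S α ⟨0, h⟩ := by
  ext A
  simp [D, initialElems, h, Fin.lt_def]

lemma P_eq_D_succ {ι : Type*} {τ : ℕ} (S : Set (Fin τ → ι)) (α : Fin τ → ι) (t : Fin τ)
    (h : (t : ℕ) + 1 < τ) : P S α t = D S α ⟨(t : ℕ) + 1, h⟩ := by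
  unfold P
  rw [dif_pos h]
  ext A
  constructor
  · rintro ⟨β, hβ, h1, h2⟩
    exact ⟨β, hβ, fun s hs => h1 s (Fin.le_def.2 (Nat.le_of_lt_succ (Fin.lt_def.1 hs))), h2⟩
  · rintro ⟨β, hβ, h1, h2⟩
    exact ⟨β, hβ, fun s hs => h1 s (Fin.lt_def.2 (Nat.lt_succ_of_le (Fin.le_def.1 hs))), h2⟩

namespace InvariantCover

variable {X U : Type*} {sys : ControlSystem X U} {Q : Set X}

lemma isSpanning_univ (C : InvariantCover sys Q) {τ : ℕ} (hτ : 0 < τ) :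
    C.IsSpanning (univ : Set (Fin τ → C.elems)) := by
  have hD : ∀ (α : Fin τ → C.elems) (t : Fin τ), D univ α t = univ := by
    intro α t
    refine eq_univ_of_forall fun A => ⟨Function.update α t A, mem_univ _, fun s hs => ?_, by simp⟩
    rw [Function.update_of_ne hs.ne]
  have hcov : Q ⊆ ⋃ A ∈ (univ : Set C.elems), (A : Set X) := by
    intro x hx
    obtain ⟨A, hA, hxA⟩ := C.covers hx
    simp only [mem_iUnion]
    exact ⟨⟨A, hA⟩, mem_univ _, hxA⟩
  refine ⟨fun x hx => ?_, fun α _ t ht => ?_⟩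
  · obtain ⟨A, hA, -⟩ := C.covers hx
    rw [initialElems_eq_D univ (fun _ => ⟨A, hA⟩) hτ, hD]
    exact hcov hx
  · rw [P_eq_D_succ _ _ _ ht, hD]
    exact (C.invariant (α t)).trans hcov

lemma isSpanning_concat (C : InvariantCover sys Q) {a b : ℕ} (ha : 0 < a) (hb : 0 < b)
    {S₁ : Set (Fin a → C.elems)} {S₂ : Set (Fin b → C.elems)} (h₁ : C.IsSpanning S₁)
    (h₂ : C.IsSpanning S₂) (hne : S₂.Nonempty) : C.IsSpanning (concat S₁ S₂) := by
  constructor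
  · intro x hx
    have := h₁.1 hx
    simp only [mem_iUnion] at this ⊢
    obtain ⟨A, ⟨β₁, hβ₁, h0, hA⟩, hxA⟩ := this
    obtain ⟨β₂, hβ₂⟩ := hne
    refine ⟨A, ⟨_, ⟨β₁, hβ₁, β₂, hβ₂, rfl⟩, by omega, ?_⟩, hxA⟩
    exact (Fin.append_left β₁ β₂ ⟨0, h0⟩).trans hA
  · rintro _ ⟨α₁, hα₁, α₂, hα₂, rfl⟩ t
    refine Fin.addCases (fun t ht => ?_) (fun t ht => ?_) t
    · rw [P_eq_D_succ _ _ _ ht, Fin.append_left]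
      rcases Nat.lt_or_ge ((t : ℕ) + 1) a with h | h
      · have := D_concat_left S₁ S₂ hne α₁ α₂ ⟨(t : ℕ) + 1, h⟩
        have e : (⟨(Fin.castAdd b t : ℕ) + 1, ht⟩ : Fin (a + b))
            = Fin.castAdd b ⟨(t : ℕ) + 1, h⟩ := Fin.ext (by simp)
        rw [e, this, ← P_eq_D_succ]
        exact h₁.2 α₁ hα₁ t h
      · have := D_concat_right S₁ S₂ α₁ hα₁ α₂ ⟨0, hb⟩
        have e : (⟨(Fin.castAdd b t : ℕ) + 1, ht⟩ : Fin (a + b))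
            = Fin.natAdd a ⟨0, hb⟩ := Fin.ext (by simp; omega)
        rw [e, this, ← initialElems_eq_D]
        exact (C.invariant (α₁ t)).trans h₂.1
    · have h : (t : ℕ) + 1 < b := by simp at ht; omega
      rw [P_eq_D_succ _ _ _ ht, Fin.append_right]
      have e : (⟨(Fin.natAdd a t : ℕ) + 1, ht⟩ : Fin (a + b))
          = Fin.natAdd a ⟨(t : ℕ) + 1, h⟩ := Fin.ext (by simp; omega)
      rw [e, D_concat_right S₁ S₂ α₁ hα₁ α₂, ← P_eq_D_succ]
      exact h₂.2 α₂ hα₂ t h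

lemma exists_spanning (C : InvariantCover sys Q) {τ : ℕ} (hτ : 0 < τ) :
    ∃ S : Set (Fin τ → C.elems), C.IsSpanning S ∧ C.rInv τ = expansionNumber S :=
  Nat.sInf_mem (s := {N | ∃ S : Set (Fin τ → C.elems), C.IsSpanning S ∧ N = expansionNumber S})
    ⟨_, univ, C.isSpanning_univ hτ, rfl⟩

lemma subadditive_logb_rInv (C : InvariantCover sys Q) (hQ : Q.Nonempty) :
    Subadditive fun τ : ℕ => Real.logb 2 (C.rInv τ) := by
  have : Finite C.elems := C.finite
  have h0 : C.rInv 0 = 0 := by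
    have : {N | ∃ S : Set (Fin 0 → C.elems), C.IsSpanning S ∧ N = expansionNumber S} = ∅ := by
      refine eq_empty_of_forall_notMem ?_
      rintro _ ⟨S, hS, rfl⟩
      obtain ⟨x, hx⟩ := hQ
      simpa [initialElems] using hS.1 hx
    simp [rInv, this]
  have hne : ∀ {τ : ℕ} {S : Set (Fin τ → C.elems)}, C.IsSpanning S → S.Nonempty := by
    intro τ S hS
    obtain ⟨x, hx⟩ := hQ
    have := hS.1 hx
    simp only [mem_iUnion] at this
    obtain ⟨A, ⟨β, hβ, -⟩, -⟩ := this
    exact ⟨β, hβ⟩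
  intro a b
  rcases Nat.eq_zero_or_pos a with rfl | ha
  · simp [h0]
  rcases Nat.eq_zero_or_pos b with rfl | hb
  · simp [h0]
  obtain ⟨S₁, h₁, e₁⟩ := C.exists_spanning ha
  obtain ⟨S₂, h₂, e₂⟩ := C.exists_spanning hb
  obtain ⟨S, hS, e⟩ := C.exists_spanning (Nat.add_pos_left ha b)
  have p₁ := one_le_expansionNumber (hne h₁)
  have p₂ := one_le_expansionNumber (hne h₂)
  have p := one_le_expansionNumber (hne hS)
  have hle : C.rInv (a + b) ≤ C.rInv a * C.rInv b := by
    have hc : C.rInv (a + b) ≤ expansionNumber (concat S₁ S₂) :=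
      Nat.sInf_le (s := {N | ∃ S : Set (Fin (a + b) → C.elems),
        C.IsSpanning S ∧ N = expansionNumber S})
        ⟨concat S₁ S₂, C.isSpanning_concat ha hb h₁ h₂ (hne h₂), rfl⟩
    rw [e₁, e₂]
    exact hc.trans (expansionNumber_concat_le S₁ S₂)
  rw [← e₁] at p₁
  rw [← e₂] at p₂
  rw [← e] at p
  dsimp only
  rw [← Real.logb_mul (by positivity) (by positivity)]
  exact Real.logb_le_logb_of_le (by norm_num) (by positivity) (by exact_mod_cast hle)

/-- The limit in the definition of the entropy exists. -/
theorem tendsto_entropy (C : InvariantCover sys Q) (hQ : Q.Nonempty) :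
    Tendsto (fun τ : ℕ => Real.logb 2 (C.rInv τ) / τ) atTop (𝓝 C.entropy) := by
  suffices hb : BddBelow (range fun τ : ℕ => Real.logb 2 (C.rInv τ) / τ) from
    tendsto_nhds_limUnder ⟨Subadditive.lim (C.subadditive_logb_rInv hQ),
      (C.subadditive_logb_rInv hQ).tendsto_lim hb⟩
  refine ⟨0, ?_⟩
  rintro _ ⟨τ, rfl⟩
  refine div_nonneg ?_ (Nat.cast_nonneg _)
  rcases Nat.eq_zero_or_pos (C.rInv τ) with h | h
  · simp [h]
  · exact Real.logb_nonneg (by norm_num) (by exact_mod_cast h)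

end InvariantCover

end InvFeedback

end

open Set Filter Topology MeasureTheory
open scoped ENNReal Pointwise

noncomputable section

namespace InvFeedback

/-! ### The Brunn–Minkowski inequality -/

/-! Everything rests on `log₂ a ≤ h(𝒜, G)` for every invariant cover. Then `h := h_inv` satisfies `a
≤ 2^h`, so `⌈a⌉ ≤ a + 1 ≤ 2^h (1 + 2^(-h))`; taking logarithms gives the first estimate, and `h ≥ 0`
gives the second.

For the lower bound write `d, q, w` for the `n`-th roots of `|det A|, μ(Q), μ(W)`. By
Brunn–Minkowski, a cover element of volume `x^n` has an image of volume at least `(d x + w)^n`. The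
image lies in `Q`, so `d x + w ≤ q`, and this forces `d x + w ≥ (d q / (q - w)) x`
(`loss_mul_pow_le`). Thus each transition multiplies volume by at least `a = (d q / (q - w))^n`. In
a spanning set the successors cover the image, so the largest successor keeps at least a `1/#P`
share of it. Always moving to the largest successor gives a sequence whose product of branching
numbers is at least `a^τ` (`pow_le_expansionNumber`), hence `a^τ ≤ r_inv(τ, Q)`.

Brunn–Minkowski itself is proved by induction on the dimension, slicing along one coordinate. -/

lemma volume_add_le_of_isCompact {A B : Set ℝ} (hA : IsCompact A) (hB : IsCompact B)
    (hA0 : A.Nonempty) (hB0 : B.Nonempty) :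
    volume A + volume B ≤ volume (A + B) := by
  obtain ⟨a, haA, ha⟩ := hA.exists_isGreatest hA0
  obtain ⟨b, hbB, hb⟩ := hB.exists_isLeast hB0
  -- With `a = max A` and `b = min B`, the two translates lie on opposite sides of `a + b` and can
  -- meet only there.
  have hd : AEDisjoint volume (b +ᵥ A) (a +ᵥ B) := by
    refine measure_mono_null (t := {a + b}) ?_ (by simp)
    rintro _ ⟨⟨x, hx, rfl⟩, ⟨y, hy, h⟩⟩
    have h1 := ha hx
    have h2 := hb hy
    simp only [vadd_eq_add, mem_singleton_iff] at h ⊢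
    linarith
  calc volume A + volume B = volume (b +ᵥ A) + volume (a +ᵥ B) := by
        rw [measure_vadd, measure_vadd]
    _ = volume ((b +ᵥ A) ∪ (a +ᵥ B)) :=
        (measure_union₀ (hB.vadd a).measurableSet.nullMeasurableSet hd).symm
    _ ≤ volume (A + B) := by
        refine measure_mono ?_
        rintro _ (⟨x, hx, rfl⟩ | ⟨y, hy, rfl⟩)
        · exact ⟨x, hx, b, hbB, by simp [add_comm]⟩
        · exact ⟨a, haA, y, hy, by simp⟩

lemma volume_add_le_of_measurableSet {A B : Set ℝ} (hA : MeasurableSet A) (hB : MeasurableSet B)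
    (hA0 : A.Nonempty) (hB0 : B.Nonempty) :
    volume A + volume B ≤ volume (A + B) := by
  obtain ⟨a, ha⟩ := hA0
  obtain ⟨b, hb⟩ := hB0
  -- A null summand is handled by a translate of the other; the approximation by compact subsets
  -- below needs both measures nonzero.
  rcases eq_or_ne (volume A) 0 with h | hA1
  · rw [h, zero_add, ← measure_vadd volume a B]
    exact measure_mono (by rintro _ ⟨y, hy, rfl⟩; exact ⟨a, ha, y, hy, rfl⟩)
  rcases eq_or_ne (volume B) 0 with h | hB1
  · rw [h, add_zero, ← measure_vadd volume b A]
    exact measure_mono (by rintro _ ⟨y, hy, rfl⟩; exact ⟨y, hy, b, hb, add_comm y b⟩)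
  refine le_of_forall_lt fun c hc => ?_
  obtain ⟨r, hr, s, hs, hrs⟩ := ENNReal.exists_lt_add_of_lt_add hc hA1 hB1
  obtain ⟨K, hKA, hK, hrK⟩ := hA.exists_lt_isCompact hr
  obtain ⟨L, hLB, hL, hsL⟩ := hB.exists_lt_isCompact hs
  have hK0 : K.Nonempty := nonempty_of_measure_ne_zero (pos_of_gt hrK).ne'
  have hL0 : L.Nonempty := nonempty_of_measure_ne_zero (pos_of_gt hsL).ne'
  calc c < r + s := hrs
    _ ≤ volume K + volume L := add_le_add hrK.le hsL.le
    _ ≤ volume (K + L) := volume_add_le_of_isCompact hK hL hK0 hL0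
    _ ≤ volume (A + B) := measure_mono (add_subset_add hKA hLB)

/-- The one-dimensional Borell–Brascamp–Lieb inequality for functions with supremum `1`. -/
lemma lintegral_add_le_of_level {f g h : ℝ → ℝ} (hf : Measurable f) (hg : Measurable g)
    (hh : Measurable h) (hf0 : ∀ s, 0 ≤ f s) (hg0 : ∀ s, 0 ≤ g s) (hh0 : ∀ s, 0 ≤ h s)
    (hf1 : ∀ s, f s ≤ 1) (hg1 : ∀ s, g s ≤ 1)
    (hfs : ∀ r < 1, ∃ s, r ≤ f s) (hgs : ∀ r < 1, ∃ s, r ≤ g s)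
    (hfg : ∀ r > 0, ∀ s t, r ≤ f s → r ≤ g t → r ≤ h (s + t)) :
    (∫⁻ s, ENNReal.ofReal (f s)) + (∫⁻ s, ENNReal.ofReal (g s)) ≤
      ∫⁻ s, ENNReal.ofReal (h s) := by
  -- Layer cake: it suffices to compare superlevel sets. The level `1` is discarded because a
  -- supremum need not be attained; below it the sets are nonempty, above it they are empty.
  rw [lintegral_eq_lintegral_meas_le volume (ae_of_all _ hf0) hf.aemeasurable,
    lintegral_eq_lintegral_meas_le volume (ae_of_all _ hg0) hg.aemeasurable,
    lintegral_eq_lintegral_meas_le volume (ae_of_all _ hh0) hh.aemeasurable]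
  refine (le_lintegral_add _ _).trans (lintegral_mono_ae ?_)
  have h1 : ∀ᵐ r ∂(volume.restrict (Ioi (0 : ℝ))), r ≠ 1 :=
    ae_restrict_of_ae (compl_mem_ae_iff.2 (Real.volume_singleton (a := 1)))
  filter_upwards [h1, ae_restrict_mem measurableSet_Ioi] with r hr hr0
  rcases lt_or_gt_of_ne hr with hr | hr
  · refine (volume_add_le_of_measurableSet (measurableSet_le measurable_const hf)
      (measurableSet_le measurable_const hg) (hfs r hr) (hgs r hr)).trans (measure_mono ?_)
    rintro _ ⟨s, hs, t, ht, rfl⟩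
    exact hfg r hr0 s t hs ht
  · have e1 : {a | r ≤ f a} = ∅ := eq_empty_of_forall_notMem fun s hs =>
      absurd (hs.trans (hf1 s)) (not_le.2 hr)
    have e2 : {a | r ≤ g a} = ∅ := eq_empty_of_forall_notMem fun s hs =>
      absurd (hs.trans (hg1 s)) (not_le.2 hr)
    simp [e1, e2]

/-- Radon's inequality for two summands. -/
lemma add_pow_succ_le_of_pos {n : ℕ} {x y F G : ℝ} (hx : 0 ≤ x) (hy : 0 ≤ y) (hF : 0 < F)
    (hG : 0 < G) :
    (x + y) ^ (n + 1) ≤ (F + G) ^ n * (x ^ (n + 1) / F ^ n + y ^ (n + 1) / G ^ n) := by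
  -- Convexity of the power, with weights `F/(F+G)`, `G/(F+G)` at the points `x/F`, `y/G`.
  have h := Real.pow_arith_mean_le_arith_mean_pow Finset.univ ![F / (F + G), G / (F + G)]
    ![x / F, y / G] (by simp [Fin.forall_fin_two]; constructor <;> positivity)
    (by simp; field_simp) (by simp [Fin.forall_fin_two]; constructor <;> positivity) (n + 1)
  simp only [Fin.sum_univ_two, Matrix.cons_val_zero, Matrix.cons_val_one] at h
  have e1 : F / (F + G) * (x / F) + G / (F + G) * (y / G) = (x + y) / (F + G) := by
    field_simp
  rw [e1, div_pow, div_le_iff₀ (by positivity)] at h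
  refine h.trans (le_of_eq ?_)
  rw [div_pow, div_pow]
  field_simp
  ring

/-- The Brunn–Minkowski inequality for compact sets. -/
def BrunnMinkowski {E : Type*} [Add E] [TopologicalSpace E] [MeasurableSpace E] (ν : Measure E)
    (n : ℕ) : Prop :=
  ∀ K L : Set E, IsCompact K → IsCompact L → K.Nonempty → L.Nonempty → ∀ x y : ℝ, 0 ≤ x → 0 ≤ y →
    ENNReal.ofReal (x ^ n) ≤ ν K → ENNReal.ofReal (y ^ n) ≤ ν L →
    ENNReal.ofReal ((x + y) ^ n) ≤ ν (K + L)

lemma brunnMinkowski_real : BrunnMinkowski (volume : Measure ℝ) 1 := by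
  intro K L hK hL hK0 hL0 x y hx hy hxK hyL
  rw [pow_one] at *
  rw [ENNReal.ofReal_add hx hy]
  exact (add_le_add hxK hyL).trans (volume_add_le_of_isCompact hK hL hK0 hL0)

/-! ### Brunn–Minkowski on a product with the line, by slicing -/

section Product

set_option linter.unusedSectionVars false

variable {E : Type*} [AddCommGroup E] [TopologicalSpace E] [IsTopologicalAddGroup E] [T2Space E]
  [SecondCountableTopology E] [MeasurableSpace E] [BorelSpace E]
  {ν : Measure E} [SFinite ν] [IsFiniteMeasureOnCompacts ν]

lemma isCompact_preimage_prodMk {K : Set (ℝ × E)} (hK : IsCompact K) (s : ℝ) :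
    IsCompact (Prod.mk s ⁻¹' K) :=
  (hK.image continuous_snd).of_isClosed_subset
    (hK.isClosed.preimage (Continuous.prodMk_right s)) fun z hz => ⟨(s, z), hz, rfl⟩

lemma measureReal_preimage_prodMk_le {K : Set (ℝ × E)} (hK : IsCompact K) (s : ℝ) :
    ν.real (Prod.mk s ⁻¹' K) ≤ ν.real (Prod.snd '' K) :=
  measureReal_mono (fun z hz => ⟨(s, z), hz, rfl⟩) (hK.image continuous_snd).measure_ne_top

lemma measurable_measureReal_preimage_prodMk {K : Set (ℝ × E)} (hK : IsCompact K) :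
    Measurable fun s : ℝ => ν.real (Prod.mk s ⁻¹' K) :=
  (measurable_measure_prodMk_left hK.measurableSet).ennreal_toReal

lemma lintegral_measureReal_preimage_prodMk {K : Set (ℝ × E)} (hK : IsCompact K) :
    ∫⁻ s : ℝ, ENNReal.ofReal (ν.real (Prod.mk s ⁻¹' K)) =
      ((volume : Measure ℝ).prod ν) K := by
  rw [Measure.prod_apply hK.measurableSet]
  exact lintegral_congr fun s =>
    ENNReal.ofReal_toReal (isCompact_preimage_prodMk hK s).measure_ne_top

/-- A compact set of positive measure has a positive supremum `F ^ n` of the measures of its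
sections. -/
lemma exists_pow_isLUB_sections {n : ℕ} (hn : n ≠ 0) {K : Set (ℝ × E)} (hK : IsCompact K)
    (h : ((volume : Measure ℝ).prod ν) K ≠ 0) :
    ∃ F : ℝ, 0 < F ∧ IsLUB (range fun s : ℝ => ν.real (Prod.mk s ⁻¹' K)) (F ^ n) := by
  have hb : BddAbove (range fun s : ℝ => ν.real (Prod.mk s ⁻¹' K)) :=
    ⟨_, by rintro _ ⟨s, rfl⟩; exact measureReal_preimage_prodMk_le hK s⟩
  have hl := isLUB_ciSup hb
  have hpos : 0 < ⨆ s : ℝ, ν.real (Prod.mk s ⁻¹' K) := by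
    by_contra! hle
    refine h ?_
    rw [← lintegral_measureReal_preimage_prodMk hK, lintegral_eq_zero_iff
      (measurable_measureReal_preimage_prodMk hK).ennreal_ofReal]
    exact ae_of_all _ fun s => ENNReal.ofReal_of_nonpos ((le_ciSup hb s).trans hle)
  refine ⟨(⨆ s : ℝ, ν.real (Prod.mk s ⁻¹' K)) ^ ((n : ℝ)⁻¹), by positivity, ?_⟩
  rwa [Real.rpow_inv_natCast_pow hpos.le hn]

lemma exists_le_div_of_isLUB {f : ℝ → ℝ} {c : ℝ} (hc : 0 < c) (h : IsLUB (range f) c) :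
    ∀ r < 1, ∃ s, r ≤ f s / c := by
  intro r hr
  obtain ⟨_, ⟨s, rfl⟩, hs, -⟩ := h.exists_between (show r * c < c by nlinarith)
  exact ⟨s, by rw [le_div_iff₀ hc]; exact hs.le⟩

lemma lintegral_ofReal_div {f : ℝ → ℝ} (hf : Measurable f) {c : ℝ} (hc : 0 < c) :
    ∫⁻ s, ENNReal.ofReal (f s / c) = ENNReal.ofReal (1 / c) * ∫⁻ s, ENNReal.ofReal (f s) := by
  rw [← lintegral_const_mul _ hf.ennreal_ofReal]
  refine lintegral_congr fun s => ?_
  rw [← ENNReal.ofReal_mul (by positivity)]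
  congr 1
  ring

/-- With `ρ = r^(1/n)`, the two sections have measure at least `(ρF)^n` and `(ρG)^n`, and their sum
lies in the section of `K + L` over `s + t`. Positivity of `r` makes the sections nonempty. -/
lemma BrunnMinkowski.section_le {n : ℕ} (hn : n ≠ 0) (h : BrunnMinkowski ν n)
    {K L : Set (ℝ × E)} (hK : IsCompact K) (hL : IsCompact L) {F G r s t : ℝ} (hF : 0 < F)
    (hG : 0 < G) (hr : 0 < r) (hs : r ≤ ν.real (Prod.mk s ⁻¹' K) / F ^ n)
    (ht : r ≤ ν.real (Prod.mk t ⁻¹' L) / G ^ n) :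
    r ≤ ν.real (Prod.mk (s + t) ⁻¹' (K + L)) / (F + G) ^ n := by
  rw [le_div_iff₀ (by positivity)] at *
  set ρ : ℝ := r ^ ((n : ℝ)⁻¹)
  have hρ : ρ ^ n = r := Real.rpow_inv_natCast_pow hr.le hn
  have hρ0 : 0 ≤ ρ := by positivity
  have ne : ∀ {T : Set E}, 0 < ν.real T → T.Nonempty := fun {T} hT => by
    by_contra hT0
    rw [not_nonempty_iff_eq_empty] at hT0
    simp [hT0] at hT
  have key := h _ _ (isCompact_preimage_prodMk hK s) (isCompact_preimage_prodMk hL t)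
    (ne ((by positivity : 0 < r * F ^ n).trans_le hs))
    (ne ((by positivity : 0 < r * G ^ n).trans_le ht)) (ρ * F) (ρ * G) (by positivity)
    (by positivity) (by
      rw [mul_pow, hρ]
      exact ENNReal.ofReal_le_of_le_toReal hs) (by
      rw [mul_pow, hρ]
      exact ENNReal.ofReal_le_of_le_toReal ht)
  rw [← mul_add, mul_pow, hρ] at key
  rw [measureReal_def, ← ENNReal.ofReal_le_iff_le_toReal
    (isCompact_preimage_prodMk (hK.add hL) (s + t)).measure_ne_top]
  refine key.trans (measure_mono ?_)
  rintro _ ⟨a, ha, b, hb, rfl⟩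
  exact ⟨(s, a), ha, (t, b), hb, rfl⟩

/-- Dividing the section measures by their suprema `F^n`, `G^n` makes the one-dimensional inequality
applicable and yields `|K|/F^n + |L|/G^n ≤ |K + L|/(F + G)^n`. Radon's inequality then removes `F`
and `G`. -/
lemma BrunnMinkowski.prod [ν.IsAddLeftInvariant] {n : ℕ} (hn : n ≠ 0) (h : BrunnMinkowski ν n) :
    BrunnMinkowski ((volume : Measure ℝ).prod ν) (n + 1) := by
  intro K L hK hL hK0 hL0 x y hx hy hxK hyL
  -- If `x` or `y` vanishes, a translate inside `K + L` suffices; otherwise both sets have positive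
  -- measure and `F, G > 0` exist.
  rcases hx.eq_or_lt with rfl | hx
  · obtain ⟨z, hz⟩ := hK0
    rw [zero_add]
    refine hyL.trans ?_
    rw [← measure_vadd ((volume : Measure ℝ).prod ν) z L]
    exact measure_mono (by rintro _ ⟨w, hw, rfl⟩; exact ⟨z, hz, w, hw, rfl⟩)
  rcases hy.eq_or_lt with rfl | hy
  · obtain ⟨z, hz⟩ := hL0
    rw [add_zero]
    refine hxK.trans ?_
    rw [← measure_vadd ((volume : Measure ℝ).prod ν) z K]
    exact measure_mono (by rintro _ ⟨w, hw, rfl⟩; exact ⟨w, hw, z, hz, add_comm w z⟩)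
  have pos : ∀ {z : ℝ} {T : Set (ℝ × E)}, 0 < z →
      ENNReal.ofReal (z ^ (n + 1)) ≤ ((volume : Measure ℝ).prod ν) T →
      ((volume : Measure ℝ).prod ν) T ≠ 0 := fun {z T} hz hT =>
    ((ENNReal.ofReal_pos.2 (by positivity)).trans_le hT).ne'
  obtain ⟨F, hF, hFK⟩ := exists_pow_isLUB_sections hn hK (pos hx hxK)
  obtain ⟨G, hG, hGL⟩ := exists_pow_isLUB_sections hn hL (pos hy hyL)
  have mK := measurable_measureReal_preimage_prodMk (ν := ν) hK
  have mL := measurable_measureReal_preimage_prodMk (ν := ν) hL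
  have mKL := measurable_measureReal_preimage_prodMk (ν := ν) (hK.add hL)
  have key := lintegral_add_le_of_level (mK.div_const (F ^ n)) (mL.div_const (G ^ n))
    (mKL.div_const ((F + G) ^ n)) (fun s => by positivity) (fun s => by positivity)
    (fun s => by positivity)
    (fun s => div_le_one_of_le₀ (hFK.1 ⟨s, rfl⟩) (by positivity))
    (fun s => div_le_one_of_le₀ (hGL.1 ⟨s, rfl⟩) (by positivity))
    (exists_le_div_of_isLUB (by positivity) hFK) (exists_le_div_of_isLUB (by positivity) hGL)
    (fun r hr s t hs ht => h.section_le hn hK hL hF hG hr hs ht)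
  rw [lintegral_ofReal_div mK (by positivity), lintegral_ofReal_div mL (by positivity),
    lintegral_ofReal_div mKL (by positivity), lintegral_measureReal_preimage_prodMk hK,
    lintegral_measureReal_preimage_prodMk hL,
    lintegral_measureReal_preimage_prodMk (hK.add hL)] at key
  have hFG : ENNReal.ofReal ((F + G) ^ n) * ENNReal.ofReal (1 / (F + G) ^ n) = 1 := by
    rw [← ENNReal.ofReal_mul (by positivity), mul_one_div_cancel (by positivity),
      ENNReal.ofReal_one]
  calc ENNReal.ofReal ((x + y) ^ (n + 1))
      ≤ ENNReal.ofReal ((F + G) ^ n * (1 / F ^ n * x ^ (n + 1) + 1 / G ^ n * y ^ (n + 1))) := by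
        refine ENNReal.ofReal_le_ofReal ((add_pow_succ_le_of_pos hx.le hy.le hF hG).trans_eq ?_)
        ring
    _ = ENNReal.ofReal ((F + G) ^ n) * (ENNReal.ofReal (1 / F ^ n) * ENNReal.ofReal (x ^ (n + 1))
          + ENNReal.ofReal (1 / G ^ n) * ENNReal.ofReal (y ^ (n + 1))) := by
        rw [ENNReal.ofReal_mul (by positivity), ENNReal.ofReal_add (by positivity) (by positivity),
          ENNReal.ofReal_mul (by positivity), ENNReal.ofReal_mul (by positivity)]
    _ ≤ ENNReal.ofReal ((F + G) ^ n) * (ENNReal.ofReal (1 / (F + G) ^ n) *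
          ((volume : Measure ℝ).prod ν) (K + L)) := by
        gcongr
        exact le_trans (by gcongr) key
    _ = ((volume : Measure ℝ).prod ν) (K + L) := by rw [← mul_assoc, hFG, one_mul]

end Product

lemma BrunnMinkowski.of_equiv {E E' : Type*} [Add E] [TopologicalSpace E] [MeasurableSpace E]
    [Add E'] [TopologicalSpace E'] [MeasurableSpace E'] {ν : Measure E} {ν' : Measure E'} {n : ℕ}
    (h : BrunnMinkowski ν n) (e : E' ≃ᵐ E) (he : MeasurePreserving e ν' ν) (hc : Continuous e)
    (hadd : ∀ a b, e (a + b) = e a + e b) : BrunnMinkowski ν' n := by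
  have hm : ∀ T : Set E', ν (e '' T) = ν' T := fun T => by
    rw [← he.measure_preimage_equiv, e.injective.preimage_image]
  intro K L hK hL hK0 hL0 x y hx hy hxK hyL
  have := h (e '' K) (e '' L) (hK.image hc) (hL.image hc) (hK0.image e) (hL0.image e) x y hx hy
    (by rwa [hm]) (by rwa [hm])
  rwa [show e '' K + e '' L = e '' (K + L) from (image_image2_distrib hadd).symm, hm] at this

theorem brunnMinkowski_pi (n : ℕ) :
    BrunnMinkowski (volume : Measure (Fin (n + 1) → ℝ)) (n + 1) := by
  induction n with
  | zero =>
    exact brunnMinkowski_real.of_equiv (MeasurableEquiv.funUnique (Fin 1) ℝ)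
      (volume_preserving_funUnique (Fin 1) ℝ) (continuous_apply _) fun _ _ => rfl
  | succ n ih =>
    exact (ih.prod n.succ_ne_zero).of_equiv
      (MeasurableEquiv.piFinSuccAbove (fun _ : Fin (n + 2) => ℝ) 0)
      (volume_preserving_piFinSuccAbove (fun _ : Fin (n + 2) => ℝ) 0)
      (by
        refine (continuous_apply _).prodMk (continuous_pi fun i => ?_)
        exact continuous_apply _) fun _ _ => rfl

/-! ### Volume growth under the dynamics -/

theorem ofReal_add_pow_le_volume_add {n : ℕ} (hn : 0 < n) {K W : Set (Fin n → ℝ)}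
    (hK : IsCompact K) (hK0 : K.Nonempty) (hW : NullMeasurableSet W volume) (hW0 : W.Nonempty)
    {x y : ℝ} (hx : 0 ≤ x) (hy : 0 ≤ y) (hxK : ENNReal.ofReal (x ^ n) ≤ volume K)
    (hyW : ENNReal.ofReal (y ^ n) ≤ volume W) :
    ENNReal.ofReal ((x + y) ^ n) ≤ volume (K + W) := by
  obtain ⟨n, rfl⟩ : ∃ k, n = k + 1 := ⟨n - 1, by omega⟩
  rcases hy.eq_or_lt with rfl | hy
  · obtain ⟨z, hz⟩ := hW0
    rw [add_zero]
    refine hxK.trans ?_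
    rw [← measure_vadd volume z K]
    exact measure_mono (by rintro _ ⟨w, hw, rfl⟩; exact ⟨w, hw, z, hz, add_comm w z⟩)
  -- For each `0 < r < y`, `W` contains a compact set of volume above `r^(n+1)`; let `r` increase to
  -- `y`.
  have hlim : Tendsto (fun r : ℝ => ENNReal.ofReal ((x + r) ^ (n + 1))) (𝓝[<] y)
      (𝓝 (ENNReal.ofReal ((x + y) ^ (n + 1)))) :=
    ((ENNReal.continuous_ofReal.comp (by fun_prop)).tendsto y).mono_left nhdsWithin_le_nhds
  refine le_of_tendsto hlim ?_
  filter_upwards [Ioo_mem_nhdsLT hy] with r hr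
  obtain ⟨M, hMW, hM, hMae⟩ := hW.exists_measurable_subset_ae_eq
  have hlt : ENNReal.ofReal (r ^ (n + 1)) < volume M := by
    rw [measure_congr hMae]
    refine lt_of_lt_of_le ?_ hyW
    rw [ENNReal.ofReal_lt_ofReal_iff (by positivity)]
    exact pow_lt_pow_left₀ hr.2 hr.1.le (by omega)
  obtain ⟨L, hLM, hL, hrL⟩ := hM.exists_lt_isCompact hlt
  exact (brunnMinkowski_pi n K L hK hL hK0 (nonempty_of_measure_ne_zero (pos_of_gt hrL).ne') x r
    hx hr.1.le hxK hrL.le).trans (measure_mono (add_subset_add_left (hLM.trans hMW)))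

/-- Volume growth of a compact set under a linear map with additive disturbance. -/
lemma add_pow_le_volume_of_mulVec_add_mem {n : ℕ} (hn : 0 < n) (A : Matrix (Fin n) (Fin n) ℝ)
    {K W R : Set (Fin n → ℝ)} (b : Fin n → ℝ) (hK : IsCompact K) (hK0 : K.Nonempty)
    (hW : NullMeasurableSet W volume) (hW0 : W.Nonempty) (hR : volume R ≠ ⊤)
    (h : ∀ x ∈ K, ∀ w ∈ W, A.mulVec x + b + w ∈ R) {d x y : ℝ} (hd : 0 ≤ d)
    (hdA : d ^ n = |A.det|) (hx : 0 ≤ x) (hxK : x ^ n = volume.real K) (hy : 0 ≤ y)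
    (hyW : ENNReal.ofReal (y ^ n) ≤ volume W) : (d * x + y) ^ n ≤ volume.real R := by
  rw [measureReal_def, ← ENNReal.ofReal_le_iff_le_toReal hR]
  have hc : Continuous fun z : Fin n → ℝ => A.mulVec z := by fun_prop
  have hAK : volume (A.mulVec '' K) = ENNReal.ofReal ((d * x) ^ n) := by
    rw [mul_pow, hdA, hxK, ENNReal.ofReal_mul (abs_nonneg _), measureReal_def,
      ENNReal.ofReal_toReal hK.measure_ne_top, ← LinearMap.det_toLin' A,
      ← Measure.addHaar_image_linearMap]
    rfl
  refine (ofReal_add_pow_le_volume_add hn (hK.image hc) (hK0.image _) hW hW0 (by positivity) hy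
    hAK.ge hyW).trans ?_
  rw [← measure_vadd volume b]
  refine measure_mono ?_
  rintro _ ⟨_, ⟨_, ⟨z, hz, rfl⟩, w, hw, rfl⟩, rfl⟩
  have := h z hz w hw
  simpa [vadd_eq_add, add_comm, add_left_comm, add_assoc] using this

/-- Before taking powers, and after clearing the denominator, the difference of the two sides is `w
(q - w - d x)`, which `h` makes nonnegative. -/
lemma loss_mul_pow_le {n : ℕ} {d q w x : ℝ} (hd : 0 ≤ d) (hw : 0 ≤ w) (hwq : w < q)
    (hx : 0 ≤ x) (h : d * x + w ≤ q) :
    d ^ n * (q ^ n / (q - w) ^ n) * x ^ n ≤ (d * x + w) ^ n := by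
  have hq : 0 < q - w := sub_pos.2 hwq
  have hq0 : 0 ≤ q := hw.trans hwq.le
  rw [← div_pow, ← mul_pow, ← mul_pow]
  refine pow_le_pow_left₀ (by positivity) ?_ n
  rw [mul_div_assoc', div_mul_eq_mul_div, div_le_iff₀ hq]
  nlinarith [mul_le_mul_of_nonneg_left h hw]

/-- Pigeonhole: take a piece of maximal measure. -/
lemma exists_mem_measureReal_le_ncard_mul {α ι : Type*} [MeasurableSpace α] {μ : Measure α}
    {J : Set ι} (hJ : J.Finite) (hJ0 : J.Nonempty) {c : ι → Set α} {R : Set α}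
    (hc : ∀ i, μ (c i) ≠ ⊤) (hR : R ⊆ ⋃ i ∈ J, c i) :
    ∃ i ∈ J, μ.real R ≤ J.ncard * μ.real (c i) := by
  obtain ⟨i, hi, hmax⟩ := exists_max_image J (fun i => μ.real (c i)) hJ hJ0
  refine ⟨i, hi, ?_⟩
  calc μ.real R ≤ μ.real (⋃ i ∈ hJ.toFinset, c i) := by
        refine measureReal_mono (by simpa using hR) ?_
        exact (measure_biUnion_lt_top (Finset.finite_toSet _) fun i _ => (hc i).lt_top).ne
    _ ≤ ∑ i ∈ hJ.toFinset, μ.real (c i) := measureReal_biUnion_finset_le _ _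
    _ ≤ hJ.toFinset.card • μ.real (c i) :=
        Finset.sum_le_card_nsmul _ _ _ fun j hj => hmax j (hJ.mem_toFinset.1 hj)
    _ = J.ncard * μ.real (c i) := by rw [ncard_eq_toFinset_card J hJ, nsmul_eq_mul]

/-! ### A greedy lower bound for expansion numbers -/

lemma D_congr {ι : Type*} {τ : ℕ} {S : Set (Fin τ → ι)} {α β : Fin τ → ι} {t : Fin τ}
    (h : ∀ s < t, α s = β s) : D S α t = D S β t := by
  ext A
  simp only [D, mem_ofPred_eq]
  constructor
  · rintro ⟨γ, hγ, h1, h2⟩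
    exact ⟨γ, hγ, fun s hs => (h1 s hs).trans (h s hs), h2⟩
  · rintro ⟨γ, hγ, h1, h2⟩
    exact ⟨γ, hγ, fun s hs => (h1 s hs).trans (h s hs).symm, h2⟩

/-- Greedy choice by induction on `k`: the heaviest successor of `α k` is realised by some `β ∈ S`
sharing the prefix of `α`, and `β` replaces `α`. -/
lemma exists_pow_mul_le_prod_D {ι : Type*} {τ : ℕ} {S : Set (Fin τ → ι)} {v : ι → ℝ} {a V : ℝ}
    (ha : 0 ≤ a) (h0 : ∃ A ∈ initialElems S, V ≤ (initialElems S).ncard * v A)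
    (h1 : ∀ α ∈ S, ∀ t : Fin τ, (t : ℕ) + 1 < τ →
      ∃ A ∈ P S α t, a * v (α t) ≤ (P S α t).ncard * v A) (k : ℕ) (hk : k < τ) :
    ∃ α ∈ S, a ^ k * V ≤ (∏ t ∈ Finset.Iic (⟨k, hk⟩ : Fin τ), ((D S α t).ncard : ℝ)) *
      v (α ⟨k, hk⟩) := by
  induction k with
  | zero =>
    obtain ⟨_, ⟨α, hα, hτ, rfl⟩, hA⟩ := h0
    refine ⟨α, hα, ?_⟩
    have e : Finset.Iic (⟨0, hk⟩ : Fin τ) = {⟨0, hk⟩} := by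
      ext t; simp [Fin.le_def, Fin.ext_iff]
    rw [e, Finset.prod_singleton, ← initialElems_eq_D S α hk, pow_zero, one_mul]
    exact hA
  | succ k ih =>
    obtain ⟨α, hα, hle⟩ := ih (by omega)
    obtain ⟨A, hAP, hA⟩ := h1 α hα ⟨k, by omega⟩ hk
    rw [P_eq_D_succ S α _ hk] at hAP hA
    obtain ⟨β, hβ, hβα, rfl⟩ := hAP
    refine ⟨β, hβ, ?_⟩
    have e : Finset.Iic (⟨k + 1, hk⟩ : Fin τ) =
        insert ⟨k + 1, hk⟩ (Finset.Iic (⟨k, by omega⟩ : Fin τ)) := by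
      ext t; simp only [Finset.mem_Iic, Finset.mem_insert, Fin.le_def, Fin.ext_iff]; omega
    -- `D S α t` depends only on the entries before `t`, so passing from `α` to `β` keeps the
    -- earlier factors.
    have hprod : ∏ t ∈ Finset.Iic (⟨k, by omega⟩ : Fin τ), ((D S β t).ncard : ℝ) =
        ∏ t ∈ Finset.Iic (⟨k, by omega⟩ : Fin τ), ((D S α t).ncard : ℝ) := by
      refine Finset.prod_congr rfl fun t ht => ?_
      rw [D_congr fun s hs => hβα s ?_]
      rw [Finset.mem_Iic, Fin.le_def] at ht
      rw [Fin.lt_def] at hs ⊢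
      simp only at *
      omega
    rw [e, Finset.prod_insert (by simp [Fin.le_def]), hprod, D_congr hβα]
    have hnn : (0 : ℝ) ≤ ∏ t ∈ Finset.Iic (⟨k, by omega⟩ : Fin τ), ((D S α t).ncard : ℝ) := by
      positivity
    calc a ^ (k + 1) * V = a * (a ^ k * V) := by ring
      _ ≤ a * ((∏ t ∈ Finset.Iic (⟨k, by omega⟩ : Fin τ), ((D S α t).ncard : ℝ)) *
            v (α ⟨k, by omega⟩)) := by gcongr
      _ = (∏ t ∈ Finset.Iic (⟨k, by omega⟩ : Fin τ), ((D S α t).ncard : ℝ)) *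
            (a * v (α ⟨k, by omega⟩)) := by ring
      _ ≤ _ := mul_le_mul_of_nonneg_left hA hnn
      _ = _ := by ring

/-- The greedy sequence has only `τ - 1` transitions; `h2`, applied to its last element, supplies
the remaining factor `a` and lets `V` cancel. -/
lemma pow_le_expansionNumber {ι : Type*} [Finite ι] {τ : ℕ} (hτ : 0 < τ) {S : Set (Fin τ → ι)}
    {v : ι → ℝ} {a V : ℝ} (ha : 0 ≤ a) (hV : 0 < V)
    (h0 : ∃ A ∈ initialElems S, V ≤ (initialElems S).ncard * v A)
    (h1 : ∀ α ∈ S, ∀ t : Fin τ, (t : ℕ) + 1 < τ →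
      ∃ A ∈ P S α t, a * v (α t) ≤ (P S α t).ncard * v A)
    (h2 : ∀ A, a * v A ≤ V) : a ^ τ ≤ expansionNumber S := by
  obtain ⟨k, rfl⟩ : ∃ k, τ = k + 1 := ⟨τ - 1, by omega⟩
  obtain ⟨α, hα, hle⟩ := exists_pow_mul_le_prod_D ha h0 h1 k k.lt_succ_self
  have e : Finset.Iic (⟨k, k.lt_succ_self⟩ : Fin (k + 1)) = Finset.univ := by
    ext t; simp [Fin.le_def]; omega
  rw [e] at hle
  refine le_of_mul_le_mul_right (a := V) ?_ hV
  calc a ^ (k + 1) * V = a * (a ^ k * V) := by ring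
    _ ≤ a * ((∏ t, ((D S α t).ncard : ℝ)) * v (α ⟨k, k.lt_succ_self⟩)) := by gcongr
    _ = (∏ t, ((D S α t).ncard : ℝ)) * (a * v (α ⟨k, k.lt_succ_self⟩)) := by ring
    _ ≤ (∏ t, ((D S α t).ncard : ℝ)) * V :=
        mul_le_mul_of_nonneg_left (h2 _) (by positivity)
    _ ≤ expansionNumber S * V := by
        gcongr
        exact_mod_cast le_expansionNumber hα

/-! ### The entropy bound for covers of the linear system -/

section LinearSystem

variable {n m : ℕ} {A : Matrix (Fin n) (Fin n) ℝ} {B : Matrix (Fin n) (Fin m) ℝ}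
  {W Q : Set (Fin n → ℝ)} {hW : W.Nonempty} {U : Set (Fin m → ℝ)} {hU : U.Nonempty}

/-- Cover elements need not be measurable. Continuity of the dynamics allows replacing them by their
closures, which are compact inside `Q`. -/
lemma mulVec_add_mem_of_mem_closure {T R : Set (Fin n → ℝ)} {u : U} (hR : IsClosed R)
    (h : (⋃ x ∈ T, (linearSystem A B W hW U hU).F x u) ⊆ R) :
    ∀ x ∈ closure T, ∀ w ∈ W, A.mulVec x + B.mulVec (u : Fin m → ℝ) + w ∈ R := by
  intro x hx w hw
  have hc : Continuous fun z : Fin n → ℝ => A.mulVec z + B.mulVec (u : Fin m → ℝ) + w := by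
    fun_prop
  refine hR.closure_subset_iff.2 ?_
    (image_closure_subset_closure_image hc (mem_image_of_mem _ hx))
  rintro _ ⟨z, hz, rfl⟩
  exact h (mem_iUnion₂.2 ⟨z, hz, w, hw, rfl⟩)

/-- The lower bound `a ^ τ ≤ r_inv(τ, Q)` for `a = (d q / (q - w)) ^ n`. -/
theorem pow_le_rInv (hn : 0 < n) (hWmeas : NullMeasurableSet W volume) (hQ : IsCompact Q)
    {d q w : ℝ} (hd : 0 ≤ d) (hdA : d ^ n = |A.det|) (hw : 0 ≤ w) (hwq : w < q)
    (hwW : ENNReal.ofReal (w ^ n) ≤ volume W) (hqQ : q ^ n = volume.real Q)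
    (C : InvariantCover (linearSystem A B W hW U hU) Q) {τ : ℕ} (hτ : 0 < τ) :
    (d ^ n * (q ^ n / (q - w) ^ n)) ^ τ ≤ C.rInv τ := by
  have : Finite C.elems := C.finite
  have hq : 0 < q := hw.trans_lt hwq
  have hV : 0 < volume.real Q := hqQ ▸ pow_pos hq n
  have hcl : ∀ T : C.elems, closure (T : Set (Fin n → ℝ)) ⊆ Q := fun T =>
    hQ.isClosed.closure_subset_iff.2 (C.subset _ T.2)
  have hcpt : ∀ T : C.elems, IsCompact (closure (T : Set (Fin n → ℝ))) := fun T =>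
    hQ.of_isClosed_subset isClosed_closure (hcl T)
  have ha : 0 ≤ d ^ n * (q ^ n / (q - w) ^ n) :=
    mul_nonneg (pow_nonneg hd n)
      (div_nonneg (pow_nonneg hq.le n) (pow_nonneg (sub_pos.2 hwq).le n))
  have growth : ∀ (T : C.elems) (R : Set (Fin n → ℝ)), IsClosed R → volume R ≠ ⊤ →
      (⋃ x ∈ (T : Set (Fin n → ℝ)), (linearSystem A B W hW U hU).F x (C.G T)) ⊆ R →
      d ^ n * (q ^ n / (q - w) ^ n) * volume.real (closure (T : Set (Fin n → ℝ))) ≤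
        volume.real R := by
    intro T R hR hRfin hTR
    rcases (closure (T : Set (Fin n → ℝ))).eq_empty_or_nonempty with h | hne
    · simp [h]
    set v := volume.real (closure (T : Set (Fin n → ℝ)))
    have hx : (v ^ ((n : ℝ)⁻¹)) ^ n = v := Real.rpow_inv_natCast_pow (by positivity) hn.ne'
    have hx0 : 0 ≤ v ^ ((n : ℝ)⁻¹) := by positivity
    have hgrow : ∀ R' : Set (Fin n → ℝ), IsClosed R' → volume R' ≠ ⊤ →
        (⋃ x ∈ (T : Set (Fin n → ℝ)), (linearSystem A B W hW U hU).F x (C.G T)) ⊆ R' →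
        (d * v ^ ((n : ℝ)⁻¹) + w) ^ n ≤ volume.real R' := fun R' h1 h2 h3 =>
      add_pow_le_volume_of_mulVec_add_mem hn A _ (hcpt T) hne hWmeas hW h2
        (mulVec_add_mem_of_mem_closure h1 h3) hd hdA hx0 hx hw hwW
    -- Volume growth is used twice: with target `Q` it gives `d x + w ≤ q`, and with target `R` it
    -- gives the estimate itself.
    have hle := hgrow Q hQ.isClosed hQ.measure_ne_top (C.invariant T)
    rw [← hqQ, pow_le_pow_iff_left₀ (by positivity) hq.le hn.ne'] at hle
    calc _ = d ^ n * (q ^ n / (q - w) ^ n) * (v ^ ((n : ℝ)⁻¹)) ^ n := by rw [hx]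
      _ ≤ _ := loss_mul_pow_le hd hw hwq hx0 hle
      _ ≤ _ := hgrow R hR hRfin hTR
  have hmono : ∀ J : Set C.elems, (⋃ T ∈ J, (T : Set (Fin n → ℝ))) ⊆
      ⋃ T ∈ J, closure (T : Set (Fin n → ℝ)) := fun J =>
    iUnion₂_mono fun T _ => subset_closure
  obtain ⟨S, hS, hSN⟩ := C.exists_spanning hτ
  rw [hSN]
  refine pow_le_expansionNumber hτ (v := fun T : C.elems => volume.real (closure (T : Set (Fin n → ℝ))))
    ha hV ?_ ?_ fun T => growth T Q hQ.isClosed hQ.measure_ne_top (C.invariant T)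
  · refine exists_mem_measureReal_le_ncard_mul (toFinite _) ?_
      (fun T => (hcpt T).measure_ne_top) (hS.1.trans (hmono _))
    obtain ⟨x, hx⟩ : Q.Nonempty := by
      by_contra h
      rw [not_nonempty_iff_eq_empty] at h
      simp [h] at hV
    obtain ⟨T, hT, -⟩ := mem_iUnion₂.1 (hS.1 hx)
    exact ⟨T, hT⟩
  · intro α hα t ht
    have hP : (P S α t).Nonempty := by
      rw [P_eq_D_succ S α t ht]
      exact ⟨_, α, hα, fun _ _ => rfl, rfl⟩
    have hclosed : IsClosed (⋃ T ∈ P S α t, closure (T : Set (Fin n → ℝ))) :=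
      (toFinite (P S α t)).isClosed_biUnion fun _ _ => isClosed_closure
    have hfin : volume (⋃ T ∈ P S α t, closure (T : Set (Fin n → ℝ))) ≠ ⊤ :=
      measure_ne_top_of_subset (iUnion₂_subset fun T _ => hcl T) hQ.measure_ne_top
    obtain ⟨T, hT, hle⟩ := exists_mem_measureReal_le_ncard_mul (μ := volume) (toFinite _) hP
      (fun T : C.elems => (hcpt T).measure_ne_top) (subset_refl _)
    exact ⟨T, hT, (growth (α t) _ hclosed hfin ((hS.2 α hα t ht).trans (hmono _))).trans hle⟩

theorem logb_le_entropy (hn : 0 < n) (hWmeas : NullMeasurableSet W volume) (hQ : IsCompact Q)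
    (hWQ : W ⊆ Q) (ha0 : 0 < (lossConstant A W Q).toReal)
    (C : InvariantCover (linearSystem A B W hW U hU) Q) :
    Real.logb 2 (lossConstant A W Q).toReal ≤ C.entropy := by
  -- `toReal` sends both `0` and `⊤` to `0`, so `ha0` excludes both.
  have hfin : lossConstant A W Q ≠ ⊤ := fun h => by simp [h] at ha0
  have hne : lossConstant A W Q ≠ 0 := fun h => by simp [h] at ha0
  have hQfin : volume Q ≠ ⊤ := hQ.measure_ne_top
  have hWfin : volume W ≠ ⊤ := measure_ne_top_of_subset hWQ hQfin
  have root : ∀ r : ℝ, 0 ≤ r → (r ^ (1 / (n : ℝ))) ^ n = r := fun r hr => by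
    rw [one_div, Real.rpow_inv_natCast_pow hr hn.ne']
  set d := |A.det| ^ (1 / (n : ℝ))
  set q := volume.real Q ^ (1 / (n : ℝ))
  set w := volume.real W ^ (1 / (n : ℝ))
  have hdA : d ^ n = |A.det| := root _ (abs_nonneg _)
  have hqQ : q ^ n = volume.real Q := root _ measureReal_nonneg
  have hwW : w ^ n = volume.real W := root _ measureReal_nonneg
  have hd : 0 ≤ d := by positivity
  have hq : 0 ≤ q := by positivity
  have hw : 0 ≤ w := by positivity
  have ofReal_root : ∀ T : Set (Fin n → ℝ), volume T ≠ ⊤ →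
      volume T ^ (1 / (n : ℝ)) = ENNReal.ofReal (volume.real T ^ (1 / (n : ℝ))) := fun T hT => by
    rw [← ENNReal.ofReal_rpow_of_nonneg measureReal_nonneg (by positivity), measureReal_def,
      ENNReal.ofReal_toReal hT]
  have hloss : lossConstant A W Q =
      ENNReal.ofReal (d ^ n) * (ENNReal.ofReal (q ^ n) / ENNReal.ofReal (q - w) ^ n) := by
    rw [lossConstant, ofReal_root Q hQfin, ofReal_root W hWfin, ← ENNReal.ofReal_sub _ hw, hdA,
      hqQ, measureReal_def, ENNReal.ofReal_toReal hQfin]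
    rfl
  -- Otherwise truncated subtraction makes the denominator `0`, and the constant is `0` or `⊤`.
  have hwq : w < q := by
    by_contra! h
    rw [hloss, ENNReal.ofReal_of_nonpos (sub_nonpos.2 h), zero_pow hn.ne'] at hfin hne
    refine hfin ?_
    rw [mul_ne_zero_iff] at hne
    rw [ENNReal.div_zero (fun h0 => hne.2 (by rw [h0, ENNReal.zero_div])),
      ENNReal.mul_top hne.1]
  have hval : (lossConstant A W Q).toReal = d ^ n * (q ^ n / (q - w) ^ n) := by
    rw [hloss, ENNReal.toReal_mul, ENNReal.toReal_div, ENNReal.toReal_pow,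
      ENNReal.toReal_ofReal (by positivity), ENNReal.toReal_ofReal (by positivity),
      ENNReal.toReal_ofReal (sub_nonneg.2 hwq.le)]
  refine ge_of_tendsto (C.tendsto_entropy (hW.mono hWQ)) ?_
  filter_upwards [eventually_gt_atTop 0] with τ hτ
  have key := pow_le_rInv hn hWmeas hQ hd hdA hw hwq
    (by rw [hwW, measureReal_def, ENNReal.ofReal_toReal hWfin]) hqQ C hτ
  rw [← hval] at key
  rw [le_div_iff₀ (by positivity), mul_comm, ← Real.logb_pow]
  exact Real.logb_le_logb_of_le (by norm_num) (by positivity) key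

end LinearSystem

/-! ### From entropy bounds to the data rate -/

lemma InvariantCover.entropy_nonneg {X U : Type*} {sys : ControlSystem X U} {Q : Set X}
    (hQ : Q.Nonempty) (C : InvariantCover sys Q) : 0 ≤ C.entropy := by
  refine ge_of_tendsto (C.tendsto_entropy hQ) (Eventually.of_forall fun τ => ?_)
  refine div_nonneg ?_ (Nat.cast_nonneg _)
  rcases Nat.eq_zero_or_pos (C.rInv τ) with h | h
  · simp [h]
  · exact Real.logb_nonneg (by norm_num) (by exact_mod_cast h)

/-- A uniform lower bound on the entropies of covers passes to a finite invariance entropy. -/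
lemma exists_invEntropy_eq_coe {X U : Type*} {sys : ControlSystem X U} {Q : Set X}
    (C : InvariantCover sys Q) {b : ℝ} (hb : ∀ C : InvariantCover sys Q, b ≤ C.entropy) :
    ∃ h : ℝ, invEntropy sys Q = (h : EReal) ∧ b ≤ h := by
  have hlow : (b : EReal) ≤ invEntropy sys Q :=
    le_iInf fun C => EReal.coe_le_coe_iff.2 (hb C)
  have hup : invEntropy sys Q ≤ (C.entropy : EReal) := iInf_le _ C
  lift invEntropy sys Q to ℝ using
    ⟨(hup.trans_lt (EReal.coe_lt_top _)).ne, ((EReal.bot_lt_coe b).trans_le hlow).ne'⟩ with h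
  exact ⟨h, rfl, EReal.coe_le_coe_iff.1 hlow⟩

/-- The left side is a real number while `log2 0 = ⊥`, so `M > 0`, and the logarithm is injective on
positive reals. -/
lemma natCast_eq_of_logb_eq_log2 {N M : ℕ} (hN : 0 < N)
    (h : (Real.logb 2 N : EReal) = log2 (M : ℝ≥0∞)) : N = M := by
  have hlog : Real.log 2 ≠ 0 := (Real.log_pos (by norm_num)).ne'
  rcases Nat.eq_zero_or_pos M with rfl | hM
  · exfalso
    have : log2 ((0 : ℕ) : ℝ≥0∞) = ⊥ := by
      rw [log2, Nat.cast_zero, ENNReal.log_zero]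
      exact EReal.bot_div_of_pos_ne_top (by exact_mod_cast Real.log_pos (by norm_num))
        (EReal.coe_ne_top _)
    rw [this] at h
    exact EReal.coe_ne_bot _ h
  · rw [log2, show (M : ℝ≥0∞) = ENNReal.ofReal (M : ℝ) by simp,
      ENNReal.log_ofReal_of_pos (by exact_mod_cast hM), ← EReal.coe_div, EReal.coe_eq_coe_iff,
      ← Real.logb] at h
    exact_mod_cast Real.logb_injOn_pos (by norm_num) (mem_Ioi.2 (by exact_mod_cast hN))
      (mem_Ioi.2 (by exact_mod_cast hM)) h

end InvFeedback

end

theorem mainTheorem5 {n m : ℕ} (hn : 0 < n)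
    (A : Matrix (Fin n) (Fin n) ℝ) (B : Matrix (Fin n) (Fin m) ℝ)
    (W Q : Set (Fin n → ℝ)) (hW : W.Nonempty) (hWQ : W ⊆ Q)
    (hWmeas : NullMeasurableSet W volume) (hQ : IsCompact Q)
    (U : Set (Fin m → ℝ)) (hU : U.Nonempty)
    (a : ℝ≥0∞) (ha : a = InvFeedback.lossConstant A W Q) (ha_fin : a < ⊤)
    (C : InvFeedback.InvariantCover (InvFeedback.linearSystem A B W hW U hU) Q)
    (hC : (C.dataRate : EReal) = InvFeedback.log2 (⌈a.toReal⌉₊ : ℝ≥0∞)) :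
    ∃ h : ℝ, InvFeedback.invEntropy (InvFeedback.linearSystem A B W hW U hU) Q = (h : EReal) ∧
      C.dataRate ≤ h + Real.logb 2 (1 + (2 : ℝ) ^ (-h)) ∧
      C.dataRate ≤ h + 1 := by
  have hQ0 : Q.Nonempty := hW.mono hWQ
  have hcard : 0 < C.elems.ncard := by
    obtain ⟨x, hx⟩ := hQ0
    obtain ⟨T, hT, -⟩ := C.covers hx
    exact (Set.ncard_pos C.finite).2 ⟨T, hT⟩
  have heq : C.elems.ncard = ⌈a.toReal⌉₊ := InvFeedback.natCast_eq_of_logb_eq_log2 hcard hC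
  have ha0 : 0 < a.toReal := Nat.ceil_pos.1 (heq ▸ hcard)
  -- The maximum with `0` records `h ≥ 0`, needed at the end for `2^(-h) ≤ 1`.
  obtain ⟨h, hh, hb⟩ := InvFeedback.exists_invEntropy_eq_coe C fun C' =>
    max_le (C'.entropy_nonneg hQ0)
      (InvFeedback.logb_le_entropy hn hWmeas hQ hWQ (ha ▸ ha0) C')
  rw [← ha] at hb
  have h0 : 0 ≤ h := (le_max_left _ _).trans hb
  have hpow : a.toReal ≤ (2 : ℝ) ^ h :=
    (Real.logb_le_iff_le_rpow (by norm_num) ha0).1 ((le_max_right _ _).trans hb)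
  have hle : (C.elems.ncard : ℝ) ≤ 2 ^ h * (1 + 2 ^ (-h)) := by
    rw [heq, mul_add, mul_one, ← Real.rpow_add (by norm_num), add_neg_cancel, Real.rpow_zero]
    exact (Nat.ceil_lt_add_one ha0.le).le.trans (by gcongr)
  have hrate : C.dataRate ≤ h + Real.logb 2 (1 + (2 : ℝ) ^ (-h)) := by
    have := Real.logb_le_logb_of_le (b := 2) (by norm_num) (by exact_mod_cast hcard) hle
    rwa [Real.logb_mul (by positivity) (by positivity), Real.logb_rpow (by norm_num)
      (by norm_num)] at this
  refine ⟨h, hh, hrate, hrate.trans (add_le_add_right ?_ h)⟩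
  rw [Real.logb_le_iff_le_rpow (by norm_num) (by positivity), Real.rpow_one]
  have : (2 : ℝ) ^ (-h) ≤ 1 := Real.rpow_le_one_of_one_le_of_nonpos (by norm_num) (by linarith)
  linarith
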